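/- For integers $e\ge 1$ and $n>1$, an \emph{$e$-star} is a complete bipartite graph $K_{1,e}$, and an \emph{$e$-star system of order $n$} is a set $\mathcal B$ of $e$-stars contained in the complete graph $K_n$ whose edge sets partition the edge set of $K_n$. A \emph{$k$-colouring} of $\mathcal B$ is an assignment of one of $k$ colours to each vertex of $K_n$ such that no star in $\mathcal B$ has all of its $e+1$ vertices of the same colour. The system is \emph{$k$-chromatic} if it has a $k$-colouring but no $(k-1)$-colouring, and it is \emph{uniquely $k$-chromatic} if it is $k$-chromatic and there is a $k$-colouring from which every $k$-colouring can be obtained by a permutation of the colours. Theorem. For all integers $e\ge 3$ and $k\ge 3$ there exists an integer $n_0$ (depending on $e$ and $k$) with $n_0\equiv 0 \pmod{2e}$ such that for every integer $n\ge n_0$ with $n\equiv 0$ or $1\pmod{2e}$ there exists a uniquely $k$-chromatic $e$-star system of order $n$. -/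

import Mathlib

/-- An `e`-star `{x; A}` (a copy of `K_{1,e}`) in the complete graph on `V`: a centre `x` and a set
`A` of `e` leaves not containing `x`. -/
structure EStar (V : Type*) (e : ℕ) where
  centre : V
  leaves : Finset V
  card_leaves : leaves.card = e
  centre_notMem : centre ∉ leaves

namespace EStar

variable {V : Type*} {e : ℕ}

/-- The edges of the star `{x; A}`: all `{x, a}` with `a ∈ A`. -/
def edgeSet (S : EStar V e) : Set (Sym2 V) :=
  {z | ∃ a ∈ S.leaves, z = s(S.centre, a)}

/-- The vertices of the star `{x; A}`: the centre and the leaves. -/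
def verts (S : EStar V e) : Set V :=
  {v | v = S.centre ∨ v ∈ S.leaves}

/-- All vertices of the star receive the same colour. -/
def Monochromatic {C : Type*} (S : EStar V e) (c : V → C) : Prop :=
  ∀ u ∈ S.verts, ∀ v ∈ S.verts, c u = c v

end EStar

/-- `B` is (the block set of) an `e`-star system on the vertex set `V`: the edge sets of its stars
partition the edge set of the complete graph on `V`. -/
def IsStarSystem {V : Type*} {e : ℕ} (B : Set (EStar V e)) : Prop :=
  ∀ z ∈ (⊤ : SimpleGraph V).edgeSet, ∃! S : EStar V e, S ∈ B ∧ z ∈ S.edgeSet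

/-- `c` is a (weak) `k`-colouring of `B`: no star of `B` is monochromatic. -/
def IsColouring {V : Type*} {e : ℕ} (B : Set (EStar V e)) {k : ℕ} (c : V → Fin k) : Prop :=
  ∀ S ∈ B, ¬ S.Monochromatic c

/-- `B` is `k`-colourable. -/
def IsColourable {V : Type*} {e : ℕ} (B : Set (EStar V e)) (k : ℕ) : Prop :=
  ∃ c : V → Fin k, IsColouring B c

/-- `B` is `k`-chromatic: `k`-colourable but not `(k - 1)`-colourable (for `k ≥ 1`). -/
def IsChromatic {V : Type*} {e : ℕ} (B : Set (EStar V e)) (k : ℕ) : Prop :=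
  IsColourable B k ∧ ¬ IsColourable B (k - 1)

/-- `B` is uniquely `k`-colourable: there is a `k`-colouring `φ` from which every `k`-colouring
is obtained by a permutation of the colours. -/
def IsUniquelyColourable {V : Type*} {e : ℕ} (B : Set (EStar V e)) (k : ℕ) : Prop :=
  ∃ φ : V → Fin k, IsColouring B φ ∧
    ∀ ψ : V → Fin k, IsColouring B ψ → ∃ σ : Equiv.Perm (Fin k), ψ = σ ∘ φ

/-- `B` is uniquely `k`-chromatic. -/
def IsUniquelyChromatic {V : Type*} {e : ℕ} (B : Set (EStar V e)) (k : ℕ) : Prop :=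
  IsChromatic B k ∧ IsUniquelyColourable B k

/-! A system on `W` is joined to one on `V` by stars centred in `W`: each `w` splits `V` freely into
`e`-sets of leaves. If `w` should get colour `i`, use one `e`-set inside every other colour class, a
chosen set `A` that is not monochromatic, and further sets meeting the complement of class `i`. The
intended colouring stays proper, its extension from `V` to `W` is forced, and no `w` can have a
colour that is constant on `A` (`IsGood.exists_append`).

Suppose every proper colouring of a good system uses at least `j` colours. Append a copy of it for
each non-monochromatic `e`-set `A`. A colouring with at most `j` colours cannot be constant on `A`,
since the copy would lose that colour and have fewer than `j` left. So its monochromatic `e`-sets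
are monochromatic in the intended colouring, which makes it a permutation of that colouring, using
all `k` colours (`exists_isGood_forcing`). For `j < k` this is absurd and `j` rises to `j + 1`; for
`j = k` it is uniqueness. Appending systems of order `2e`, and at most one single point, gives all
larger orders. -/

/-! ### Star systems as labellings -/

/-- A star labelling of `V`: `β x y = some l` says that `y` is a leaf of the star number `l` centred
at `x`. Every pair of distinct points is an edge of exactly one star, and every star has `e`
leaves. -/
structure IsStarLabelling {V : Type*} (e : ℕ) (β : V → V → Option ℕ) : Prop where
  irrefl : ∀ x, β x x = none
  asymm : ∀ x y, x ≠ y → (β x y = none ↔ β y x ≠ none)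
  ncard_block : ∀ x y l, β x y = some l → {z | β x z = some l}.ncard = e

/-- No star of the labelling is monochromatic under `c`. -/
def IsProper {V C : Type*} (β : V → V → Option ℕ) (c : V → C) : Prop :=
  ∀ x y l, β x y = some l → ∃ z, β x z = some l ∧ c z ≠ c x

/-- The stars of a labelling. -/
def starsOf {V : Type*} (e : ℕ) (β : V → V → Option ℕ) : Set (EStar V e) :=
  {S | ∃ l, ∀ z, z ∈ S.leaves ↔ β S.centre z = some l}

namespace IsStarLabelling

variable {V W : Type*} {e : ℕ} {β : V → V → Option ℕ}

theorem exists_star (h : IsStarLabelling e β) (he : 0 < e) {x y : V} {l : ℕ}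
    (hl : β x y = some l) :
    ∃ S ∈ starsOf e β, S.centre = x ∧ ∀ z, z ∈ S.leaves ↔ β x z = some l := by
  have hc := h.ncard_block x y l hl
  have hf : {z | β x z = some l}.Finite := Set.finite_of_ncard_pos (by omega)
  refine ⟨⟨x, hf.toFinset, ?_, ?_⟩, ⟨l, ?_⟩, rfl, ?_⟩
  · rw [← hc, Set.ncard_eq_toFinset_card _ hf]
  · simp [h.irrefl]
  · simp
  · simp

theorem existsUnique_star (h : IsStarLabelling e β) (he : 0 < e) {x y : V} {l : ℕ}
    (hl : β x y = some l) : ∃! S : EStar V e, S ∈ starsOf e β ∧ s(x, y) ∈ S.edgeSet := by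
  have hxy : x ≠ y := by
    rintro rfl
    simp [h.irrefl] at hl
  have hyx : β y x = none := (h.asymm y x hxy.symm).2 (by simp [hl])
  obtain ⟨S, hS, rfl, hz⟩ := h.exists_star he hl
  refine ⟨S, ⟨hS, y, (hz y).2 hl, rfl⟩, ?_⟩
  rintro ⟨c, A, hA, hcA⟩ ⟨⟨l', hl'⟩, a, ha, hs⟩
  dsimp only at hl' ha hs
  rw [Sym2.eq_iff] at hs
  rcases hs with ⟨rfl, rfl⟩ | ⟨h1, rfl⟩
  · have : l' = l := by
      have := (hl' y).1 ha
      rw [hl] at this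
      simpa using this.symm
    subst this
    obtain ⟨c, A', hA', hcA'⟩ := S
    have : A = A' := by
      ext z
      rw [hl', hz]
    subst this
    rfl
  · have := (hl' _).1 ha
    rw [← h1, hyx] at this
    simp at this

theorem isStarSystem (h : IsStarLabelling e β) (he : 0 < e) : IsStarSystem (starsOf e β) := by
  intro z hz
  induction z with
  | _ x y =>
    have hxy : x ≠ y := by simpa using hz
    by_cases h0 : β x y = none
    · obtain ⟨l, hl⟩ := Option.ne_none_iff_exists'.1 ((h.asymm x y hxy).1 h0)
      rw [Sym2.eq_swap]
      exact h.existsUnique_star he hl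
    · obtain ⟨l, hl⟩ := Option.ne_none_iff_exists'.1 h0
      exact h.existsUnique_star he hl

theorem isColouring_iff (h : IsStarLabelling e β) (he : 0 < e) {k : ℕ} (c : V → Fin k) :
    IsColouring (starsOf e β) c ↔ IsProper β c := by
  constructor
  · intro hc x y l hl
    by_contra! hcon
    obtain ⟨S, hS, rfl, hz⟩ := h.exists_star he hl
    have key : ∀ u ∈ S.verts, c u = c S.centre := by
      rintro u (rfl | hu)
      · rfl
      · exact hcon u ((hz u).1 hu)
    exact hc S hS fun u hu v hv => (key u hu).trans (key v hv).symm
  · rintro hc S ⟨l, hl⟩ hm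
    obtain ⟨y, hy⟩ : S.leaves.Nonempty := by
      rw [← Finset.card_pos, S.card_leaves]
      exact he
    obtain ⟨z, hz, hne⟩ := hc _ _ _ ((hl y).1 hy)
    exact hne (hm z (Or.inr ((hl z).2 hz)) S.centre (Or.inl rfl))

theorem transport (h : IsStarLabelling e β) (f : V ≃ W) :
    IsStarLabelling e fun x y => β (f.symm x) (f.symm y) where
  irrefl x := h.irrefl _
  asymm x y hxy := h.asymm _ _ (by simpa using hxy)
  ncard_block x y l hl := by
    rw [← h.ncard_block _ _ _ hl, ← Set.ncard_image_of_injective _ f.symm.injective]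
    congr 1
    ext z
    simp

end IsStarLabelling

theorem IsProper.transport {V W C : Type*} {β : V → V → Option ℕ} {c : V → C} (h : IsProper β c)
    (f : V ≃ W) : IsProper (fun x y => β (f.symm x) (f.symm y)) (c ∘ f.symm) := by
  intro x y l hl
  obtain ⟨z, hz, hne⟩ := h _ _ _ hl
  exact ⟨f z, by simpa using hz, by simpa using hne⟩

theorem IsProper.of_transport {V W C : Type*} {β : V → V → Option ℕ} {c : W → C} (f : V ≃ W)
    (h : IsProper (fun x y => β (f.symm x) (f.symm y)) c) : IsProper β (c ∘ f) := by
  have := h.transport f.symm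
  simpa using this

/-- A surjective proper colouring which is unique up to a permutation of the colours. -/
structure IsUniqueProper {V : Type*} {k : ℕ} (β : V → V → Option ℕ) (φ : V → Fin k) : Prop where
  surjective : Function.Surjective φ
  proper : IsProper β φ
  unique : ∀ ψ : V → Fin k, IsProper β ψ → ∃ σ : Equiv.Perm (Fin k), ψ = σ ∘ φ

theorem IsUniqueProper.isUniquelyChromatic {V : Type*} {e k : ℕ} {β : V → V → Option ℕ}
    {φ : V → Fin k} (h : IsUniqueProper β φ) (hβ : IsStarLabelling e β) (he : 0 < e) (hk : 0 < k) :
    IsUniquelyChromatic (starsOf e β) k := by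
  refine ⟨⟨⟨φ, (hβ.isColouring_iff he φ).2 h.proper⟩, ?_⟩,
    φ, (hβ.isColouring_iff he φ).2 h.proper, fun ψ hψ =>
      h.unique ψ ((hβ.isColouring_iff he ψ).1 hψ)⟩
  rintro ⟨c, hc⟩
  have hle : k - 1 ≤ k := by omega
  -- A `(k - 1)`-colouring is a `k`-colouring missing a colour, but permutations of `φ` are
  -- surjective.
  have hp : IsProper β (Fin.castLE hle ∘ c) := by
    intro x y l hl
    obtain ⟨z, hz, hne⟩ := (hβ.isColouring_iff he c).1 hc x y l hl
    exact ⟨z, hz, fun h => hne (Fin.castLE_injective hle h)⟩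
  obtain ⟨σ, hσ⟩ := h.unique _ hp
  have hs : Function.Surjective (Fin.castLE hle ∘ c) := by
    rw [hσ]
    exact σ.surjective.comp h.surjective
  have := Fintype.card_le_of_surjective _ hs.of_comp
  simp only [Fintype.card_fin] at this
  omega

theorem IsUniqueProper.exists_system {V : Type*} [Fintype V] {e k : ℕ} {β : V → V → Option ℕ}
    {φ : V → Fin k} (h : IsUniqueProper β φ) (hβ : IsStarLabelling e β) (he : 0 < e) (hk : 0 < k)
    {n : ℕ} (hn : Fintype.card V = n) :
    ∃ B : Set (EStar (Fin n) e), IsStarSystem B ∧ IsUniquelyChromatic B k := by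
  let f : V ≃ Fin n := Fintype.equivFinOfCardEq hn
  have hβ' := hβ.transport f
  refine ⟨_, hβ'.isStarSystem he, IsUniqueProper.isUniquelyChromatic (φ := φ ∘ f.symm)
    ⟨h.surjective.comp f.symm.surjective, h.proper.transport f, fun ψ hψ => ?_⟩ hβ' he hk⟩
  obtain ⟨σ, hσ⟩ := h.unique _ (hψ.of_transport f)
  refine ⟨σ, ?_⟩
  rw [← Function.comp_assoc, ← hσ]
  ext
  simp

/-! ### Joining two systems -/

/-- The labelling on `V ⊕ W` in which the points of `W` are joined to `V` by stars centred in `W`,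
those centred at `w` being the fibres of `q w`. -/
def sumLabelling {V W : Type*} (β₁ : V → V → Option ℕ) (β₂ : W → W → Option ℕ) (q : W → V → ℕ) :
    V ⊕ W → V ⊕ W → Option ℕ
  | .inl v, .inl v' => β₁ v v'
  | .inl _, .inr _ => none
  -- Parity separates the stars at `w` with leaves in `V` from those with leaves in `W`.
  | .inr w, .inl v => some (2 * q w v)
  | .inr w, .inr w' => (β₂ w w').map (2 * · + 1)

section Sum

variable {V W C : Type*} {e : ℕ} {β₁ : V → V → Option ℕ} {β₂ : W → W → Option ℕ} {q : W → V → ℕ}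

theorem IsStarLabelling.sum (h₁ : IsStarLabelling e β₁) (h₂ : IsStarLabelling e β₂)
    (hq : ∀ w v, {z | q w z = q w v}.ncard = e) :
    IsStarLabelling e (sumLabelling β₁ β₂ q) where
  irrefl := by
    rintro (v | w) <;> simp [sumLabelling, h₁.irrefl, h₂.irrefl]
  asymm := by
    rintro (v | w) (v' | w') hne
    · exact h₁.asymm v v' (by simpa using hne)
    · simp [sumLabelling]
    · simp [sumLabelling]
    · simpa [sumLabelling] using h₂.asymm w w' (by simpa using hne)
  ncard_block := by
    rintro (v | w) (v' | w') l hl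
    · rw [← h₁.ncard_block v v' l hl, ← Set.ncard_image_of_injective _
      (Sum.inl_injective (α := V) (β := W))]
      congr 1
      ext (z | z) <;> simp [sumLabelling]
    · simp [sumLabelling] at hl
    · obtain rfl : 2 * q w v' = l := by simpa [sumLabelling] using hl
      rw [← hq w v', ← Set.ncard_image_of_injective _
        (Sum.inl_injective (α := V) (β := W))]
      congr 1
      ext (z | z)
      · simp [sumLabelling]
      · simp only [sumLabelling, Option.map_eq_some_iff, Set.mem_ofPred_eq, Set.mem_image,
          reduceCtorEq, and_false, exists_false, iff_false, not_exists, not_and]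
        intro a _
        omega
    · obtain ⟨l', hl', rfl⟩ : ∃ l', β₂ w w' = some l' ∧ 2 * l' + 1 = l := by
        simpa [sumLabelling] using hl
      rw [← h₂.ncard_block w w' l' hl', ← Set.ncard_image_of_injective _
        (Sum.inr_injective (α := V) (β := W))]
      congr 1
      ext (z | z)
      · simp only [sumLabelling, Option.some.injEq, Set.mem_ofPred_eq, Set.mem_image,
          reduceCtorEq, and_false, exists_false, iff_false]
        omega
      · simp [sumLabelling]

theorem isProper_sumLabelling {c : V ⊕ W → C} :
    IsProper (sumLabelling β₁ β₂ q) c ↔ IsProper β₁ (c ∘ Sum.inl) ∧ IsProper β₂ (c ∘ Sum.inr) ∧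
      ∀ w v, ∃ z, q w z = q w v ∧ c (Sum.inl z) ≠ c (Sum.inr w) := by
  constructor
  · intro h
    refine ⟨fun x y l hl => ?_, fun x y l hl => ?_, fun w v => ?_⟩
    · obtain ⟨z | z, hz, hne⟩ := h (.inl x) (.inl y) l hl
      · exact ⟨z, hz, hne⟩
      · simp [sumLabelling] at hz
    · obtain ⟨z | z, hz, hne⟩ := h (.inr x) (.inr y) (2 * l + 1) (by simp [sumLabelling, hl])
      · simp only [sumLabelling, Option.some.injEq] at hz
        omega
      · exact ⟨z, by simpa [sumLabelling] using hz, hne⟩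
    · obtain ⟨z | z, hz, hne⟩ := h (.inr w) (.inl v) _ rfl
      · exact ⟨z, by simpa [sumLabelling] using hz, hne⟩
      · simp only [sumLabelling, Option.map_eq_some_iff] at hz
        obtain ⟨a, -, ha⟩ := hz
        omega
  · rintro ⟨h₁, h₂, h₃⟩ (x | x) (y | y) l hl
    · obtain ⟨z, hz, hne⟩ := h₁ x y l hl
      exact ⟨.inl z, hz, hne⟩
    · simp [sumLabelling] at hl
    · obtain rfl : 2 * q x y = l := by simpa [sumLabelling] using hl
      obtain ⟨z, hz, hne⟩ := h₃ x y
      exact ⟨.inl z, by simp [sumLabelling, hz], hne⟩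
    · obtain ⟨l', hl', rfl⟩ : ∃ l', β₂ x y = some l' ∧ 2 * l' + 1 = l := by
        simpa [sumLabelling] using hl
      obtain ⟨z, hz, hne⟩ := h₂ x y l' hl'
      exact ⟨.inr z, by simp [sumLabelling, hz], hne⟩

end Sum

/-! ### Partitions into prescribed and free blocks -/

/-- A finite set of size `(|ι| + b) e` can be partitioned into `e`-sets so that the given disjoint
`e`-sets `F t` are parts and each of the `b` further parts meets `Z`. -/
theorem exists_partition {V ι : Type*} [Fintype V] [Fintype ι] [DecidableEq V] {e b : ℕ}
    (he : 0 < e)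
    (F : ι → Finset V) (hF : ∀ t, (F t).card = e) (hdis : Pairwise (Function.onFun Disjoint F))
    (hcard : Fintype.card V = (Fintype.card ι + b) * e) (Z : Finset V) (hb : b ≤ Z.card)
    (hZ : ∀ t, Disjoint (F t) Z) :
    ∃ q : V → ι ⊕ Fin b, (∀ s, {z | q z = s}.ncard = e) ∧ (∀ t v, q v = .inl t ↔ v ∈ F t) ∧
      ∀ a, ∃ z ∈ Z, q z = .inr a := by
  classical
  obtain ⟨Z', hZ', hZ'c⟩ := Finset.exists_subset_card_eq hb
  let ζ : Fin b ≃ Z' := (Finset.equivFinOfCardEq hZ'c).symm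
  let η (t : ι) : Fin e ≃ F t := (Finset.equivFinOfCardEq (hF t)).symm
  let f : (ι ⊕ Fin b) × Fin e → V := fun p => Sum.elim (fun t => (η t p.2 : V)) (fun a => ζ a) p.1
  -- The slots filled in advance: all of each `F t`, and one point of `Z` in each free block. Any
  -- bijective extension will do.
  let s : Finset ((ι ⊕ Fin b) × Fin e) := {p | ∀ a, p.1 = .inr a → p.2 = ⟨0, he⟩}
  have hsep : ∀ t x a, (η t x : V) ≠ ζ a := fun t x a =>
    Finset.disjoint_left.1 (hZ t) (η t x).2 |> fun h1 h2 => h1 (h2 ▸ hZ' (ζ a).2)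
  have hinj : Set.InjOn f s := by
    rintro ⟨t | a, x⟩ hp ⟨t' | a', y⟩ hp' hxy
    · have h1 : (η t x : V) = η t' y := hxy
      obtain rfl : t = t' := by
        by_contra hne
        exact Finset.disjoint_left.1 (hdis hne) (η t x).2 (h1 ▸ (η t' y).2)
      have := (η t).injective (Subtype.ext h1)
      rw [this]
    · exact absurd hxy (hsep _ _ _)
    · exact absurd hxy.symm (hsep _ _ _)
    · have h1 : (ζ a : V) = ζ a' := hxy
      have h2 := ζ.injective (Subtype.ext h1)
      simp [s] at hp hp'
      rw [h2, hp, hp']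
  obtain ⟨g, hg⟩ := Finset.exists_equiv_extend_of_card_eq (t := Finset.univ) (s := s) (f := f)
    (by simp [hcard]) (Finset.subset_univ _) hinj
  have hq : ∀ p, (g.symm ⟨(g p : V), Finset.mem_univ _⟩) = p := fun p => by simp
  refine ⟨fun v => (g.symm ⟨v, Finset.mem_univ _⟩).1, fun c => ?_, fun t v => ⟨fun h => ?_, ?_⟩,
    fun a => ?_⟩
  · have : {z | (g.symm ⟨z, Finset.mem_univ _⟩).1 = c} =
        (fun x : Fin e => (g (c, x) : V)) '' Set.univ := by
      ext z
      simp only [Set.mem_ofPred_eq, Set.image_univ, Set.mem_range]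
      constructor
      · intro h
        refine ⟨(g.symm ⟨z, Finset.mem_univ _⟩).2, ?_⟩
        rw [← h]
        simp
      · rintro ⟨x, rfl⟩
        simp
    rw [this, Set.ncard_image_of_injective, Set.ncard_univ, Nat.card_fin]
    intro x y hxy
    simpa using g.injective (Subtype.ext hxy)
  · have h1 : (g (.inl t, (g.symm ⟨v, Finset.mem_univ _⟩).2) : V) = v := by
      rw [← h]
      simp
    rw [← h1, hg _ (by simp [s])]
    exact (η t _).2
  · intro hv
    have h1 : v = g (.inl t, (η t).symm ⟨v, hv⟩) := by
      rw [hg _ (by simp [s])]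
      simp [f]
    have := hq (.inl t, (η t).symm ⟨v, hv⟩)
    simp only [← h1] at this
    exact congrArg Prod.fst this
  · have h1 := hg (.inr a, ⟨0, he⟩) (by simp [s])
    refine ⟨g (.inr a, ⟨0, he⟩), ?_, by simp⟩
    rw [h1]
    exact hZ' (ζ a).2

/-- The points of colour `j`. -/
def colourClass {V C : Type*} [Fintype V] [DecidableEq C] (φ : V → C) (j : C) : Finset V :=
  {v | φ v = j}

@[simp]
theorem mem_colourClass {V C : Type*} [Fintype V] [DecidableEq C] {φ : V → C} {j : C} {v : V} :
    v ∈ colourClass φ j ↔ φ v = j := by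
  simp [colourClass]

theorem card_colourClass_sumElim {V W C : Type*} [Fintype V] [Fintype W] [DecidableEq C]
    (φ₁ : V → C) (φ₂ : W → C) (j : C) : (colourClass (Sum.elim φ₁ φ₂) j).card =
      (colourClass φ₁ j).card + (colourClass φ₂ j).card := by
  have : colourClass (Sum.elim φ₁ φ₂) j = (colourClass φ₁ j).disjSum (colourClass φ₂ j) := by
    ext (v | w) <;> simp
  rw [this, Finset.card_disjSum]

/-- The number of points is divisible by `2 e` and no colour is used on more than half of them. -/
structure IsBalanced {V : Type*} [Fintype V] (e : ℕ) {k : ℕ} (φ : V → Fin k) : Prop where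
  dvd : 2 * e ∣ Fintype.card V
  two_mul_le : ∀ j, 2 * (colourClass φ j).card ≤ Fintype.card V

theorem IsBalanced.sum {V W : Type*} [Fintype V] [Fintype W] {e k : ℕ} {φ₁ : V → Fin k}
    {φ₂ : W → Fin k} (h₁ : IsBalanced e φ₁) (h₂ : IsBalanced e φ₂) :
    IsBalanced e (Sum.elim φ₁ φ₂) where
  dvd := by
    rw [Fintype.card_sum]
    exact dvd_add h₁.dvd h₂.dvd
  two_mul_le j := by
    rw [Fintype.card_sum, card_colourClass_sumElim]
    have := h₁.two_mul_le j
    have := h₂.two_mul_le j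
    omega

/-- Balance leaves enough points of colour other than `i` to put one in every free block. The labels
are numbered in `ℕ` to serve as star labels. -/
theorem IsBalanced.exists_blocks {V ι : Type*} [Fintype V] [Fintype ι] [DecidableEq V] {e k : ℕ}
    {φ : V → Fin k} (h : IsBalanced e φ) (he : 3 ≤ e) (i : Fin k) (F : ι → Finset V)
    (hF : ∀ t, (F t).card = e) (hdis : Pairwise (Function.onFun Disjoint F))
    (hi : ∀ t, ∃ v ∈ F t, φ v ≠ i) (hsize : 4 * Fintype.card ι * e ≤ Fintype.card V) :
    ∃ q : V → ℕ, (∀ v, {z | q z = q v}.ncard = e) ∧ (∀ v, ∃ z, q z = q v ∧ φ z ≠ i) ∧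
      ∀ t, ∃ u, ∀ z, q z = q u → z ∈ F t := by
  obtain ⟨m, hm⟩ := h.dvd
  set r := Fintype.card ι with hr
  have hmr : 2 * r ≤ m := by
    rw [hm] at hsize
    have h1 : (2 * e) * (2 * r) ≤ (2 * e) * m := by linarith
    exact Nat.le_of_mul_le_mul_left h1 (by omega)
  obtain ⟨s, rfl⟩ := Nat.exists_eq_add_of_le hmr
  let Z : Finset V := ((colourClass φ i)ᶜ) \ Finset.univ.biUnion F
  have hU : (Finset.univ.biUnion F).card ≤ r * e := by
    refine Finset.card_biUnion_le.trans ?_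
    simp [hF, hr]
  -- There are `2m = 4r + 2s` blocks, of which `3r + 2s` are free, while `Z` has at least `em - re =
  -- e(r + s)` points; `e ≥ 3` suffices.
  have hb : 3 * r + 2 * s ≤ Z.card := by
    have h1 : (colourClass φ i)ᶜ.card - (Finset.univ.biUnion F).card ≤ Z.card :=
      Finset.le_card_sdiff _ _
    rw [Finset.card_compl] at h1
    have h2 := h.two_mul_le i
    have h3 : Fintype.card V = 4 * (r * e) + 2 * (e * s) := by rw [hm]; ring
    have h4 : 3 * r ≤ r * e := by nlinarith
    have h5 : 3 * s ≤ e * s := by nlinarith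
    omega
  obtain ⟨q, hq1, hq2, hq3⟩ := exists_partition (b := 3 * r + 2 * s) (by omega : 0 < e) F hF hdis
    (by rw [hm, ← hr]; ring) Z hb (fun t => by
      refine Finset.disjoint_left.2 fun v hv hvZ => (Finset.mem_sdiff.1 hvZ).2 ?_
      exact Finset.mem_biUnion.2 ⟨t, Finset.mem_univ _, hv⟩)
  let ε := Fintype.equivFin (ι ⊕ Fin (3 * r + 2 * s))
  have hε : ∀ x y, (ε (q x) : ℕ) = ε (q y) ↔ q x = q y := fun x y => by
    rw [Fin.val_inj, ε.injective.eq_iff]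
  refine ⟨fun v => ε (q v), fun v => ?_, fun v => ?_, fun t => ?_⟩
  · simp only [hε]
    exact hq1 _
  · simp only [hε]
    rcases hv : q v with t | a
    · obtain ⟨z, hz, hne⟩ := hi t
      exact ⟨z, (hq2 t z).2 hz, hne⟩
    · obtain ⟨z, hz, hqz⟩ := hq3 a
      exact ⟨z, hqz, by simpa using (Finset.mem_sdiff.1 hz).1⟩
  · obtain ⟨u, hu, -⟩ := hi t
    refine ⟨u, fun z hz => ?_⟩
    rw [hε, (hq2 t u).2 hu] at hz
    exact (hq2 t z).1 hz

/-! ### Good systems and appending -/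

/-- A star labelling with a balanced proper colouring all of whose classes are large. -/
structure IsGood {V : Type*} [Fintype V] (e : ℕ) {k : ℕ} (β : V → V → Option ℕ) (φ : V → Fin k) :
    Prop where
  labelling : IsStarLabelling e β
  proper : IsProper β φ
  balanced : IsBalanced e φ
  le_card : ∀ j, 2 * k * e ≤ (colourClass φ j).card

theorem IsGood.exists_blocks {V : Type*} [Fintype V] {e k : ℕ} {β : V → V → Option ℕ}
    {φ : V → Fin k} (h : IsGood e β φ) (he : 3 ≤ e) (i : Fin k) (A : Finset V)
    (hAe : A.card = e) (hA : ∃ a ∈ A, φ a ≠ i) :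
    ∃ q : V → ℕ, (∀ v, {z | q z = q v}.ncard = e) ∧ (∀ v, ∃ z, q z = q v ∧ φ z ≠ i) ∧
      (∃ u, ∀ z, q z = q u → z ∈ A) ∧ ∀ j ≠ i, ∃ u, ∀ z, q z = q u → φ z = j := by
  classical
  have hk : 1 ≤ k := i.pos
  have hM : ∀ j, ∃ M ⊆ colourClass φ j \ A, M.card = e := fun j => by
    refine Finset.exists_subset_card_eq ?_
    have h1 : (colourClass φ j).card - A.card ≤ (colourClass φ j \ A).card :=
      Finset.le_card_sdiff _ _
    have h2 := h.le_card j
    have h3 : 2 * 1 * e ≤ 2 * k * e := by gcongr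
    omega
  choose M hM hMe using hM
  have hMj : ∀ j, ∀ v ∈ M j, φ v = j ∧ v ∉ A := fun j v hv => by simpa using hM j hv
  -- The `k` prescribed blocks; the bound `2 * k * e` on the classes and balance give the required
  -- `4ke` points.
  let F : Option {j // j ≠ i} → Finset V := fun t => t.elim A fun j => M j
  have hF : ∀ t, (F t).card = e := by
    rintro (_ | j)
    exacts [hAe, hMe j]
  have hdis : Pairwise (Function.onFun Disjoint F) := by
    rintro (_ | j) (_ | j') hne
    · exact absurd rfl hne
    · exact Finset.disjoint_right.2 fun v hv => (hMj _ v hv).2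
    · exact Finset.disjoint_left.2 fun v hv => (hMj _ v hv).2
    · refine Finset.disjoint_left.2 fun v hv hv' => hne ?_
      exact congrArg some (Subtype.ext ((hMj _ v hv).1.symm.trans (hMj _ v hv').1))
  have hFi : ∀ t, ∃ v ∈ F t, φ v ≠ i := by
    rintro (_ | j)
    · exact hA
    · obtain ⟨v, hv⟩ : (M j).Nonempty := by
        rw [← Finset.card_pos, hMe]
        omega
      exact ⟨v, hv, by rw [(hMj _ v hv).1]; exact j.2⟩
  have hcard : Fintype.card (Option {j // j ≠ i}) = k := by
    simp
    omega
  have hsize : 4 * Fintype.card (Option {j // j ≠ i}) * e ≤ Fintype.card V := by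
    rw [hcard]
    have h2 := h.le_card i
    have h3 := h.balanced.two_mul_le i
    linarith
  obtain ⟨q, hq1, hq2, hq3⟩ := h.balanced.exists_blocks he i F hF hdis hFi hsize
  exact ⟨q, hq1, hq2, hq3 none, fun j hj => (hq3 (some ⟨j, hj⟩)).imp fun u hu z hz =>
    (hMj j z (hu z hz)).1⟩

theorem IsGood.exists_append {V W : Type*} [Fintype V] {e k : ℕ}
    {β₁ : V → V → Option ℕ} {φ₁ : V → Fin k} (h₁ : IsGood e β₁ φ₁) (he : 3 ≤ e)
    {β₂ : W → W → Option ℕ} {φ₂ : W → Fin k} (h₂ : IsStarLabelling e β₂) (hφ₂ : IsProper β₂ φ₂)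
    (A : Finset V) (hAe : A.card = e) (hA : ∀ i, ∃ a ∈ A, φ₁ a ≠ i) :
    ∃ β : V ⊕ W → V ⊕ W → Option ℕ, IsStarLabelling e β ∧ IsProper β (Sum.elim φ₁ φ₂) ∧
      ∀ ψ : V ⊕ W → Fin k, IsProper β ψ → IsProper β₁ (ψ ∘ Sum.inl) ∧ IsProper β₂ (ψ ∘ Sum.inr) ∧
        (∀ w, ∃ a ∈ A, ψ (.inl a) ≠ ψ (.inr w)) ∧
        ∀ σ : Equiv.Perm (Fin k), ψ ∘ Sum.inl = σ ∘ φ₁ → ψ = σ ∘ Sum.elim φ₁ φ₂ := by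
  choose q hq1 hq2 hq3 hq4 using fun w => h₁.exists_blocks he (φ₂ w) A hAe (hA _)
  refine ⟨sumLabelling β₁ β₂ q, h₁.labelling.sum h₂ hq1,
    isProper_sumLabelling.2 ⟨h₁.proper, hφ₂, hq2⟩, fun ψ hψ => ?_⟩
  obtain ⟨hψ1, hψ2, hψ3⟩ := isProper_sumLabelling.1 hψ
  refine ⟨hψ1, hψ2, fun w => ?_, fun σ hσ => ?_⟩
  · obtain ⟨u, hu⟩ := hq3 w
    obtain ⟨z, hz, hne⟩ := hψ3 w u
    exact ⟨z, hu z hz, hne⟩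
  · funext x
    rcases x with v | w
    · exact congrFun hσ v
    · by_contra hne
      -- A wrong colour at `w` is `σ j` with `j ≠ φ₂ w`, and then the star from `w` into class `j`
      -- is monochromatic.
      obtain ⟨u, hu⟩ := hq4 w (σ.symm (ψ (.inr w))) fun h => hne (by simp [← h])
      obtain ⟨z, hz, hne'⟩ := hψ3 w u
      refine hne' ((congrFun hσ z).trans ?_)
      simp [hu z hz]

theorem IsGood.sum {V W : Type*} [Fintype V] [Fintype W] {e k : ℕ}
    {β₁ : V → V → Option ℕ} {φ₁ : V → Fin k} (h₁ : IsGood e β₁ φ₁) {φ₂ : W → Fin k}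
    (h₂ : IsBalanced e φ₂) {β : V ⊕ W → V ⊕ W → Option ℕ} (hβ : IsStarLabelling e β)
    (hp : IsProper β (Sum.elim φ₁ φ₂)) : IsGood e β (Sum.elim φ₁ φ₂) :=
  ⟨hβ, hp, h₁.balanced.sum h₂, fun j => by
    rw [card_colourClass_sumElim]
    exact (h₁.le_card j).trans (Nat.le_add_right _ _)⟩

theorem IsGood.surjective {V : Type*} [Fintype V] {e k : ℕ} {β : V → V → Option ℕ}
    {φ : V → Fin k} (h : IsGood e β φ) (he : 0 < e) : Function.Surjective φ := by
  intro j
  have h1 := h.le_card j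
  have h2 : 0 < 2 * k * e := Nat.mul_pos (Nat.mul_pos two_pos j.pos) he
  obtain ⟨v, hv⟩ := Finset.card_pos.1 (h2.trans_le h1)
  exact ⟨v, by simpa using hv⟩

/-! ### Forcing uniqueness -/

/-- If the classes of `φ` are large and every `e`-set on which `ψ` is constant is one on which `φ`
is constant, then `ψ` is obtained from `φ` by permuting the colours. -/
theorem exists_perm_of_forall_card_eq {V : Type*} [Fintype V] {e k : ℕ} (he : 2 ≤ e)
    {φ ψ : V → Fin k} (hφ : ∀ j, k * e ≤ (colourClass φ j).card)
    (h : ∀ A : Finset V, A.card = e → (∀ a ∈ A, ∀ b ∈ A, ψ a = ψ b) →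
      ∀ a ∈ A, ∀ b ∈ A, φ a = φ b) :
    ∃ σ : Equiv.Perm (Fin k), ψ = σ ∘ φ := by
  classical
  -- Pigeonhole: some `ψ`-colour `g i` occurs `e` times in class `i`.
  have hg : ∀ i, ∃ d, e ≤ ({v ∈ colourClass φ i | ψ v = d} : Finset V).card := fun i => by
    obtain ⟨d, -, hd⟩ := Finset.exists_le_card_fiber_of_mul_le_card_of_maps_to
      (s := colourClass φ i) (t := Finset.univ) (f := ψ) (n := e) (fun _ _ => Finset.mem_univ _)
      ⟨i, Finset.mem_univ _⟩ (by simpa using hφ i)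
    exact ⟨d, hd⟩
  choose g hg using hg
  have key : ∀ i v, ψ v = g i → φ v = i := by
    intro i v hv
    by_contra hne
    -- Adding `v` to `e - 1` points of class `i` gives an `e`-set constant under `ψ` but not under
    -- `φ`.
    obtain ⟨B, hB, hBe⟩ := Finset.exists_subset_card_eq (show e - 1 ≤ _ from
      (Nat.sub_le _ _).trans (hg i))
    have hB' : ∀ b ∈ B, φ b = i ∧ ψ b = g i := fun b hb => by simpa using hB hb
    have hvB : v ∉ B := fun hb => hne (hB' v hb).1
    obtain ⟨b, hb⟩ : B.Nonempty := by
      rw [← Finset.card_pos]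
      omega
    have hψ : ∀ a ∈ insert v B, ψ a = g i := by
      intro a ha
      rcases Finset.mem_insert.1 ha with rfl | ha
      exacts [hv, (hB' a ha).2]
    have := h (insert v B) (by rw [Finset.card_insert_of_notMem hvB]; omega)
      (fun a ha b hb => (hψ a ha).trans (hψ b hb).symm) v (Finset.mem_insert_self _ _) b
      (Finset.mem_insert_of_mem hb)
    exact hne (this.trans (hB' b hb).1)
  have hinj : Function.Injective g := by
    intro i j hij
    obtain ⟨v, hv⟩ := Finset.card_pos.1 ((by omega : 0 < e).trans_le (hg i))
    rw [Finset.mem_filter, mem_colourClass] at hv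
    exact hv.1.symm.trans (key j v (hv.2.trans hij))
  refine ⟨Equiv.ofBijective g (Finite.injective_iff_bijective.1 hinj), ?_⟩
  funext v
  obtain ⟨i, hi⟩ := (Finite.injective_iff_bijective.1 hinj).2 (ψ v)
  rw [Function.comp_apply, key i v hi.symm]
  exact hi.symm

/-- Appending to a good system one copy of a fixed system, all of whose proper colourings use at
least `j` colours, for each member of `𝒜`. -/
theorem exists_iterated_append {V W : Type} [Fintype V] [Fintype W] {e k j : ℕ} (he : 3 ≤ e)
    {β₁ : V → V → Option ℕ} {φ₁ : V → Fin k} (h₁ : IsGood e β₁ φ₁)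
    {β₂ : W → W → Option ℕ} {φ₂ : W → Fin k} (h₂ : IsGood e β₂ φ₂)
    (hj : ∀ ψ : W → Fin k, IsProper β₂ ψ → j ≤ (Set.range ψ).ncard)
    (𝒜 : Finset (Finset V)) (h𝒜 : ∀ A ∈ 𝒜, A.card = e ∧ ∀ i, ∃ a ∈ A, φ₁ a ≠ i) :
    ∃ (Y : Type) (_ : Fintype Y) (ι : V → Y) (β : Y → Y → Option ℕ) (φ : Y → Fin k),
      IsGood e β φ ∧ Function.Injective ι ∧ φ ∘ ι = φ₁ ∧ ∀ ψ : Y → Fin k, IsProper β ψ →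
        ((Set.range ψ).ncard ≤ j → ∀ A ∈ 𝒜, ∃ a ∈ A, ∃ b ∈ A, ψ (ι a) ≠ ψ (ι b)) ∧
        ∀ σ : Equiv.Perm (Fin k), ψ ∘ ι = σ ∘ φ₁ → ψ = σ ∘ φ := by
  classical
  induction 𝒜 using Finset.induction_on with
  | empty =>
    exact ⟨V, inferInstance, id, β₁, φ₁, h₁, Function.injective_id, rfl, fun ψ _ =>
      ⟨fun _ A hA => absurd hA (Finset.notMem_empty A), fun σ hσ => hσ⟩⟩
  | insert A 𝒜 _ ih =>
    obtain ⟨Y, _, ι, β, φ, hg, hι, hφ, hψ⟩ := ih fun A hA => h𝒜 A (Finset.mem_insert_of_mem hA)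
    obtain ⟨hAe, hA⟩ := h𝒜 A (Finset.mem_insert_self _ _)
    obtain ⟨β', hl, hp, hf⟩ := hg.exists_append he h₂.labelling h₂.proper (A.image ι)
      (by rw [Finset.card_image_of_injective _ hι, hAe]) (fun i => by
        obtain ⟨a, ha, hne⟩ := hA i
        exact ⟨ι a, Finset.mem_image_of_mem _ ha, by rwa [← hφ] at hne⟩)
    refine ⟨Y ⊕ W, inferInstance, Sum.inl ∘ ι, β', Sum.elim φ φ₂, hg.sum h₂.balanced hl hp,
      Sum.inl_injective.comp hι, ?_, fun ψ hψp => ?_⟩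
    · rw [← Function.comp_assoc, Sum.elim_comp_inl, hφ]
    obtain ⟨f1, f2, f3, f4⟩ := hf ψ hψp
    obtain ⟨g1, g2⟩ := hψ _ f1
    refine ⟨fun hle A' hA' => ?_, fun σ hσ => f4 σ (g2 σ hσ)⟩
    rcases Finset.mem_insert.1 hA' with rfl | hA'
    · by_contra! hcon
      obtain ⟨a, ha⟩ : A'.Nonempty := by
        rw [← Finset.card_pos]
        omega
      -- The new copy misses the colour of `A'`, so it uses fewer than `j` colours.
      have hss : Set.range (ψ ∘ Sum.inr) ⊂ Set.range ψ := by
        refine Set.ssubset_iff_exists.2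
          ⟨Set.range_comp_subset_range _ _, ψ (.inl (ι a)), ⟨_, rfl⟩, ?_⟩
        rintro ⟨w, hw⟩
        obtain ⟨b, hb, hne⟩ := f3 w
        obtain ⟨b, hb', rfl⟩ := Finset.mem_image.1 hb
        exact hne ((hcon b hb' a ha).trans hw.symm)
      have := hj _ f2
      have := Set.ncard_lt_ncard hss (Set.toFinite _)
      omega
    · refine g1 (le_trans (Set.ncard_le_ncard ?_ (Set.toFinite _)) hle) A' hA'
      exact Set.range_comp_subset_range _ _

/-- The copies appended are of the system itself, one per non-monochromatic `e`-set. -/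
theorem exists_isGood_forcing {V : Type} [Fintype V] {e k j : ℕ} (he : 3 ≤ e)
    {β : V → V → Option ℕ} {φ : V → Fin k} (h : IsGood e β φ)
    (hj : ∀ ψ : V → Fin k, IsProper β ψ → j ≤ (Set.range ψ).ncard) :
    ∃ (Y : Type) (_ : Fintype Y) (β' : Y → Y → Option ℕ) (φ' : Y → Fin k), IsGood e β' φ' ∧
      ∀ ψ : Y → Fin k, IsProper β' ψ → (Set.range ψ).ncard ≤ j →
        ∃ σ : Equiv.Perm (Fin k), ψ = σ ∘ φ' := by
  classical
  obtain ⟨Y, _, ι, β', φ', hg, hι, hφ, hψ⟩ := exists_iterated_append he h h hj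
    {A | A.card = e ∧ ∀ i, ∃ a ∈ A, φ a ≠ i} (by simp)
  refine ⟨Y, inferInstance, β', φ', hg, fun ψ hp hle => ?_⟩
  obtain ⟨h1, h2⟩ := hψ ψ hp
  obtain ⟨σ, hσ⟩ := exists_perm_of_forall_card_eq (φ := φ) (ψ := ψ ∘ ι) (by omega : 2 ≤ e)
    (fun j => le_trans (Nat.mul_le_mul_right _ (by omega)) (h.le_card j)) fun A hAe hA a ha b hb => by
      by_contra hne
      obtain ⟨c, hc, d, hd, hcd⟩ := h1 hle A (by
        simp only [Finset.mem_filter, Finset.mem_univ, true_and]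
        refine ⟨hAe, fun i => ?_⟩
        by_contra! hi
        exact hne ((hi a ha).trans (hi b hb).symm))
      exact hcd (hA c hc d hd)
  exact ⟨σ, h2 σ hσ⟩

theorem exists_isGood_ncard_range {e k : ℕ} (he : 3 ≤ e)
    (h₀ : ∃ (V : Type) (_ : Fintype V) (β : V → V → Option ℕ) (φ : V → Fin k), IsGood e β φ)
    (j : ℕ) (hj : j ≤ k) :
    ∃ (V : Type) (_ : Fintype V) (β : V → V → Option ℕ) (φ : V → Fin k), IsGood e β φ ∧
      ∀ ψ : V → Fin k, IsProper β ψ → j ≤ (Set.range ψ).ncard := by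
  induction j with
  | zero =>
    obtain ⟨V, _, β, φ, h⟩ := h₀
    exact ⟨V, _, β, φ, h, fun _ _ => Nat.zero_le _⟩
  | succ j ih =>
    obtain ⟨V, _, β, φ, h, hψ⟩ := ih (by omega)
    obtain ⟨Y, _, β', φ', h', hψ'⟩ := exists_isGood_forcing he h hψ
    refine ⟨Y, _, β', φ', h', fun ψ hp => ?_⟩
    by_contra! hlt
    obtain ⟨σ, rfl⟩ := hψ' ψ hp (by omega)
    have := (σ.surjective.comp (h'.surjective (by omega))).range_eq
    rw [this, Set.ncard_univ, Nat.card_fin] at hlt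
    omega

theorem exists_isGood_isUniqueProper {e k : ℕ} (he : 3 ≤ e)
    (h₀ : ∃ (V : Type) (_ : Fintype V) (β : V → V → Option ℕ) (φ : V → Fin k), IsGood e β φ) :
    ∃ (V : Type) (_ : Fintype V) (β : V → V → Option ℕ) (φ : V → Fin k), IsGood e β φ ∧
      IsUniqueProper β φ := by
  obtain ⟨V, _, β, φ, h, hψ⟩ := exists_isGood_ncard_range he h₀ k le_rfl
  obtain ⟨Y, _, β', φ', h', hψ'⟩ := exists_isGood_forcing he h hψ
  refine ⟨Y, _, β', φ', h', h'.surjective (by omega), h'.proper, fun ψ hp => hψ' ψ hp ?_⟩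
  refine (Set.ncard_le_ncard (Set.subset_univ _) (Set.toFinite _)).trans ?_
  rw [Set.ncard_univ, Nat.card_fin]

/-! ### Construction of a good system -/

/-- A star has `e + 1` vertices, too many for one class. -/
theorem IsStarLabelling.isProper_of_card_le {V C : Type*} [Fintype V] [DecidableEq C] {e : ℕ}
    {β : V → V → Option ℕ} (h : IsStarLabelling e β) {c : V → C}
    (hc : ∀ j, (colourClass c j).card ≤ e) : IsProper β c := by
  intro x y l hl
  by_contra! hcon
  have h1 : insert x {z | β x z = some l} ⊆ (colourClass c (c x) : Set V) := by
    rintro z (rfl | hz)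
    · simp
    · simpa using hcon z hz
  have h2 := Set.ncard_le_ncard h1 (Set.toFinite _)
  rw [Set.ncard_insert_of_notMem (by simp [h.irrefl]) (Set.toFinite _), h.ncard_block x y l hl,
    Set.ncard_coe_finset] at h2
  have := hc (c x)
  omega

/-- The star system of order `2 (d + 1)` with one star centred at each point but one. -/
def rotationalLabelling (d : ℕ) :
    Option (ZMod (2 * d + 1)) → Option (ZMod (2 * d + 1)) → Option ℕ
  | none, _ => none
  | some _, none => some 0
  | some a, some b => if 1 ≤ (b - a).val ∧ (b - a).val ≤ d then some 0 else none

theorem isStarLabelling_rotationalLabelling (d : ℕ) :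
    IsStarLabelling (d + 1) (rotationalLabelling d) where
  irrefl := by
    rintro (_ | a) <;> simp [rotationalLabelling]
  asymm := by
    rintro (_ | a) (_ | b) hne
    · exact absurd rfl hne
    · simp [rotationalLabelling]
    · simp [rotationalLabelling]
    · have hab : b - a ≠ 0 := fun h => hne (by rw [sub_eq_zero.1 h])
      have h1 : (a - b).val = 2 * d + 1 - (b - a).val := by
        rw [← neg_sub, ZMod.neg_val, if_neg hab]
      have h2 := ZMod.val_lt (b - a)
      have h3 : (b - a).val ≠ 0 := by rwa [Ne, ZMod.val_eq_zero]
      simp only [rotationalLabelling, h1, ite_eq_right_iff, reduceCtorEq, imp_false, ne_eq,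
        not_not]
      omega
  ncard_block := by
    rintro (_ | a) y l hl
    · simp [rotationalLabelling] at hl
    obtain rfl : l = 0 := by
      rcases y with _ | b
      · simpa [rotationalLabelling] using hl.symm
      · simp only [rotationalLabelling, Option.ite_none_right_eq_some, Option.some.injEq] at hl
        exact hl.2.symm
    -- The leaves of the star at `a` are infinity and `a + 1, …, a + d`.
    have h1 : {z | rotationalLabelling d (some a) z = some 0} =
        insert none ((fun t : ℕ => some (a + (t : ZMod (2 * d + 1)))) '' Set.Icc 1 d) := by
      ext (_ | b)
      · simp [rotationalLabelling]
      · simp only [rotationalLabelling, Option.ite_none_right_eq_some, and_true, Set.mem_ofPred_eq,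
          Set.mem_insert_iff, reduceCtorEq, false_or, Set.mem_image, Set.mem_Icc,
          Option.some.injEq]
        constructor
        · intro h
          exact ⟨_, h, by simp⟩
        · rintro ⟨t, ht, rfl⟩
          rwa [add_sub_cancel_left, ZMod.val_natCast_of_lt (by omega)]
    rw [h1, Set.ncard_insert_of_notMem (by simp) (Set.toFinite _), Set.InjOn.ncard_image,
      Set.ncard_eq_toFinset_card']
    · simp
    · intro s hs t ht hst
      have h2 : (s : ZMod (2 * d + 1)) = t := by simpa using hst
      have h3 := congrArg ZMod.val h2
      rw [Set.mem_Icc] at hs ht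
      rwa [ZMod.val_natCast_of_lt (by omega), ZMod.val_natCast_of_lt (by omega)] at h3

theorem exists_labelling_two_colours {e k : ℕ} (he : 0 < e) {a b : Fin k} (hab : a ≠ b) :
    ∃ β : Fin e ⊕ Fin e → Fin e ⊕ Fin e → Option ℕ, IsStarLabelling e β ∧
      IsProper β (Sum.elim (fun _ => a) (fun _ => b)) ∧
      IsBalanced e (Sum.elim (fun _ : Fin e => a) (fun _ : Fin e => b)) := by
  obtain ⟨d, rfl⟩ : ∃ d, e = d + 1 := ⟨e - 1, by omega⟩
  have hc : ∀ j, (colourClass (Sum.elim (fun _ : Fin (d + 1) => a) fun _ : Fin (d + 1) => b) j).card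
      ≤ d + 1 := by
    intro j
    rw [card_colourClass_sumElim]
    rcases eq_or_ne a j with rfl | ha
    · simp [colourClass, hab.symm]
    · have h2 := Finset.card_le_univ (colourClass (fun _ : Fin (d + 1) => b) j)
      simpa [colourClass, ha] using h2
  let f : Option (ZMod (2 * d + 1)) ≃ Fin (d + 1) ⊕ Fin (d + 1) := Fintype.equivOfCardEq (by
    simp [ZMod.card]
    ring)
  have h := (isStarLabelling_rotationalLabelling d).transport f
  refine ⟨_, h, h.isProper_of_card_le hc, ⟨2 * 0 + 1, by simp; ring⟩, fun j => ?_⟩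
  have := hc j
  simp only [Fintype.card_sum, Fintype.card_fin]
  omega

/-- Each entry `a` of `m` appends a two-coloured system with `e` points of colour `a`. With no
prescribed blocks, balance alone permits this, even from the empty system. -/
theorem exists_balanced_le_card {e k : ℕ} (he : 3 ≤ e) (hk : 2 ≤ k) (m : Multiset (Fin k)) :
    ∃ (V : Type) (_ : Fintype V) (β : V → V → Option ℕ) (φ : V → Fin k), IsStarLabelling e β ∧
      IsProper β φ ∧ IsBalanced e φ ∧ ∀ j, m.count j * e ≤ (colourClass φ j).card := by
  classical
  induction m using Multiset.induction_on with
  | empty =>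
    exact ⟨Empty, inferInstance, fun x => x.elim, fun x => x.elim, ⟨fun x => x.elim, fun x => x.elim,
      fun x => x.elim⟩, fun x => x.elim, ⟨by simp, fun j => by simp [colourClass]⟩, by simp⟩
  | cons a m ih =>
    obtain ⟨V, _, β₁, φ₁, hl₁, hp₁, hb₁, hm⟩ := ih
    have : Nontrivial (Fin k) := Fin.nontrivial_iff_two_le.2 hk
    obtain ⟨b, hb⟩ := exists_ne a
    obtain ⟨β₂, hl₂, hp₂, hb₂⟩ := exists_labelling_two_colours (e := e) (by omega) hb.symm
    choose q hq1 hq2 hq3 using fun w : Fin e ⊕ Fin e => hb₁.exists_blocks he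
      (Sum.elim (fun _ => a) (fun _ => b) w) (fun t : Empty => t.elim) (fun t => t.elim)
      (fun t => t.elim) (fun t => t.elim) (by simp)
    refine ⟨V ⊕ (Fin e ⊕ Fin e), inferInstance, sumLabelling β₁ β₂ q,
      Sum.elim φ₁ (Sum.elim (fun _ => a) fun _ => b), hl₁.sum hl₂ hq1,
      isProper_sumLabelling.2 ⟨hp₁, hp₂, hq2⟩, hb₁.sum hb₂, fun j => ?_⟩
    rw [card_colourClass_sumElim, card_colourClass_sumElim, Multiset.count_cons, add_mul]
    refine add_le_add (hm j) ?_
    split_ifs with h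
    · simp [colourClass, h]
    · simp

theorem exists_isGood {e k : ℕ} (he : 3 ≤ e) (hk : 2 ≤ k) :
    ∃ (V : Type) (_ : Fintype V) (β : V → V → Option ℕ) (φ : V → Fin k), IsGood e β φ := by
  obtain ⟨V, _, β, φ, h1, h2, h3, h4⟩ := exists_balanced_le_card he hk
    ((2 * k) • (Finset.univ : Finset (Fin k)).val)
  refine ⟨V, _, β, φ, h1, h2, h3, fun j => ?_⟩
  have h5 := h4 j
  rwa [Multiset.count_nsmul, Multiset.count_eq_one_of_mem Finset.univ.nodup (Finset.mem_univ j),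
    mul_one] at h5

/-! ### Reaching all large orders -/

theorem IsGood.exists_nonconstant {V : Type*} [Fintype V] {e k : ℕ} {β : V → V → Option ℕ}
    {φ : V → Fin k} (h : IsGood e β φ) (he : 2 ≤ e) (hk : 2 ≤ k) :
    ∃ A : Finset V, A.card = e ∧ ∀ i, ∃ a ∈ A, φ a ≠ i := by
  classical
  obtain ⟨x, hx⟩ := h.surjective (by omega) ⟨0, by omega⟩
  obtain ⟨y, hy⟩ := h.surjective (by omega) ⟨1, by omega⟩
  have hxy : φ x ≠ φ y := by simp [hx, hy]
  have hne : x ≠ y := fun h => hxy (h ▸ rfl)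
  obtain ⟨A, hA, -, hAe⟩ := Finset.exists_subsuperset_card_eq (s := {x, y}) (t := Finset.univ)
    (n := e) (Finset.subset_univ _) (by rwa [Finset.card_pair hne]) (by
      have h1 := h.le_card (φ x)
      have h2 := Finset.card_le_univ (colourClass φ (φ x))
      rw [Finset.card_univ]
      nlinarith)
  refine ⟨A, hAe, fun i => ?_⟩
  by_contra! hi
  exact hxy ((hi x (hA (by simp))).trans (hi y (hA (by simp))).symm)

/-- Nothing is asked of the size or balance of `W`, so it may be a single point. -/
theorem IsUniqueProper.exists_append {V W : Type} [Fintype V] {e k : ℕ} {β₁ : V → V → Option ℕ}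
    {φ₁ : V → Fin k} (hu : IsUniqueProper β₁ φ₁) (h₁ : IsGood e β₁ φ₁) (he : 3 ≤ e) (hk : 2 ≤ k)
    {β₂ : W → W → Option ℕ} {φ₂ : W → Fin k} (h₂ : IsStarLabelling e β₂) (hφ₂ : IsProper β₂ φ₂) :
    ∃ β : V ⊕ W → V ⊕ W → Option ℕ, IsStarLabelling e β ∧ IsUniqueProper β (Sum.elim φ₁ φ₂) := by
  obtain ⟨A, hAe, hA⟩ := h₁.exists_nonconstant (by omega) hk
  obtain ⟨β, hl, hp, hf⟩ := h₁.exists_append he h₂ hφ₂ A hAe hA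
  refine ⟨β, hl, fun j => ?_, hp, fun ψ hψ => ?_⟩
  · obtain ⟨v, hv⟩ := hu.surjective j
    exact ⟨.inl v, hv⟩
  · obtain ⟨f1, -, -, f4⟩ := hf ψ hψ
    obtain ⟨σ, hσ⟩ := hu.unique _ f1
    exact ⟨σ, f4 σ hσ⟩

theorem exists_isGood_isUniqueProper_card {V : Type} [Fintype V] {e k : ℕ} (he : 3 ≤ e)
    (hk : 2 ≤ k) {β : V → V → Option ℕ} {φ : V → Fin k} (h : IsGood e β φ)
    (hu : IsUniqueProper β φ) (t : ℕ) :
    ∃ (Y : Type) (_ : Fintype Y) (β' : Y → Y → Option ℕ) (φ' : Y → Fin k), IsGood e β' φ' ∧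
      IsUniqueProper β' φ' ∧ Fintype.card Y = Fintype.card V + 2 * e * t := by
  induction t with
  | zero => exact ⟨V, _, β, φ, h, hu, rfl⟩
  | succ t ih =>
    obtain ⟨Y, _, β₁, φ₁, h₁, hu₁, hY⟩ := ih
    obtain ⟨β₂, hl₂, hp₂, hb₂⟩ := exists_labelling_two_colours (e := e) (k := k) (by omega)
      (a := ⟨0, by omega⟩) (b := ⟨1, by omega⟩) (by simp)
    obtain ⟨β', hl, hu'⟩ := hu₁.exists_append h₁ he hk hl₂ hp₂
    refine ⟨Y ⊕ (Fin e ⊕ Fin e), inferInstance, β', _, h₁.sum hb₂ hl hu'.proper, hu', ?_⟩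
    simp only [Fintype.card_sum, Fintype.card_fin, hY]
    ring

theorem mainTheorem3 (e k : ℕ) (he : 3 ≤ e) (hk : 3 ≤ k) :
    ∃ n₀ : ℕ, n₀ ≡ 0 [MOD 2 * e] ∧
      ∀ n : ℕ, n₀ ≤ n → (n ≡ 0 [MOD 2 * e] ∨ n ≡ 1 [MOD 2 * e]) →
        ∃ B : Set (EStar (Fin n) e), IsStarSystem B ∧ IsUniquelyChromatic B k := by
  obtain ⟨V, _, β, φ, h, hu⟩ := exists_isGood_isUniqueProper he
    (exists_isGood (k := k) he (by omega))
  have hdvd : Fintype.card V ≡ 0 [MOD 2 * e] := Nat.modEq_zero_iff_dvd.2 h.balanced.dvd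
  refine ⟨Fintype.card V, hdvd, fun n hn hmod => ?_⟩
  rcases hmod with hmod | hmod
  · obtain ⟨t, ht⟩ := (Nat.modEq_iff_dvd' hn).1 (hdvd.trans hmod.symm)
    obtain ⟨Y, _, β', φ', h', hu', hY⟩ :=
      exists_isGood_isUniqueProper_card he (by omega) h hu t
    exact hu'.exists_system h'.labelling (by omega) (by omega) (by omega)
  · have hn' : Fintype.card V + 1 ≤ n := by
      rcases hn.eq_or_lt with rfl | hlt
      · have h1 : 1 ≡ 0 [MOD 2 * e] := hmod.symm.trans hdvd
        have := Nat.le_of_dvd one_pos (Nat.modEq_zero_iff_dvd.1 h1)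
        omega
      · exact hlt
    obtain ⟨t, ht⟩ := (Nat.modEq_iff_dvd' hn').1 ((hdvd.add_right 1).trans hmod.symm)
    obtain ⟨Y, _, β₁, φ₁, h₁, hu₁, hY⟩ :=
      exists_isGood_isUniqueProper_card he (by omega) h hu t
    -- The one-point system has no stars. Appending it destroys balance, so it comes last.
    obtain ⟨β', hl, hu'⟩ := hu₁.exists_append (W := Unit) (β₂ := fun _ _ => none)
      (φ₂ := fun _ => ⟨0, by omega⟩) h₁ he (by omega)
      ⟨fun _ => rfl, fun x y hxy => absurd (Subsingleton.elim x y) hxy, fun _ _ _ hl => by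
        simp at hl⟩ (fun _ _ _ hl => by simp at hl)
    refine hu'.exists_system hl (by omega) (by omega) ?_
    simp only [Fintype.card_sum, Fintype.card_unit]
    omega
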